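/- Fix $\alpha\in(0,1)$ and a constant $K>0$. Let $$\Theta=\mathbb R\times\Big\{P \text{ probability measure on } \mathbb R:\ \int x\,dP=0,\ \int x^2\,dP\in(0,\infty)\Big\},$$ and for $\theta=(\theta_1,P)\in\Theta$ let $P_\theta$ be the law of $\xi=\theta_1+V$ with $V\sim P$; write $\mathbb P_\theta$ for the law $P_\theta^{\otimes n}$ of an i.i.d. sample $\xi_1,\dots,\xi_n$ from $P_\theta$. Let $\sigma(\theta)^2=\mathbb V_\theta(\xi)$, $\lambda_3(\theta)=\mathbb E_\theta[(\xi-\mathbb E_\theta\xi)^3]/\sigma(\theta)^3$, $K_4(\theta)=\mathbb E_\theta[(\xi-\mathbb E_\theta\xi)^4]/\sigma(\theta)^4\in[0,\infty]$, and $\Theta_{\mathrm{EE}}=\{\theta\in\Theta: K_4(\theta)\le K\}$. Let $\Phi$, $\varphi$ and $q$ be the distribution function, density and quantile function of $\mathcal N(0,1)$, let $S_n=\sum_{i=1}^n(\xi_i-\mathbb E_\theta\xi)/(\sigma(\theta)\sqrt n)$, and put $$\Delta_{n,\mathrm B}(\theta)=\sup_{x\in\mathbb R}\big|\mathbb P_\theta(S_n\le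 x)-\Phi(x)\big|,\qquad \Delta_{n,\mathrm E}(\theta)=\sup_{x\in\mathbb R}\Big|\mathbb P_\theta(S_n\le x)-\Phi(x)-\frac{\lambda_3(\theta)}{6\sqrt n}(1-x^2)\varphi(x)\Big|.$$ Let $\bar\xi_n=n^{-1}\sum_{i=1}^n\xi_i$ and $\widehat\sigma^2=n^{-1}\sum_{i=1}^n(\xi_i-\bar\xi_n)^2$. For real sequences $(\delta_n)$ and $(a_n)$ put $\nu_n=\exp\!\big(-n(1-1/a_n)^2/(2K)\big)$, $\tau_n=1-\alpha/2+\delta_n+\nu_n/2$, $C_n=\big(1/a_n-q(\tau_n)^2/n\big)^{-1/2}$, and $$\mathrm{CI}_n(\widehat\sigma)=\begin{cases}\Big[\bar\xi_n-\dfrac{\widehat\sigma}{\sqrt n}C_n\,q(\tau_n),\ \bar\xi_n+\dfrac{\widehat\sigma}{\sqrt n}C_n\,q(\tau_n)\Big] & \text{if } \tau_n<\Phi(\sqrt{n/a_n}),\\[2mm] \mathbb R&\text{otherwise.}\end{cases}$$ **Proposition.** Assume that $\delta_n\ge\sup_{\theta\in\Theta_{\mathrm{EE}}}\min\{\Delta_{n,\mathrm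 E}(\theta),\Delta_{n,\mathrm B}(\theta)\}$ for every $n\ge1$, that $\delta_n\to0$, and that $b_n:=a_n-1$ satisfies $b_n\to0$ and $b_n\sqrt n\to+\infty$. Then (i) $\mathrm{CI}_n(\widehat\sigma)$ is asymptotically exact pointwise over $\Theta$ at level $1-\alpha$: for every $\theta=(\theta_1,P)\in\Theta$, $\ \lim_{n\to\infty}\mathbb P_\theta\big(\theta_1\in\mathrm{CI}_n(\widehat\sigma)\big)=1-\alpha$; (ii) $\mathrm{CI}_n(\widehat\sigma)$ is asymptotically exact uniformly over $\Theta_{\mathrm{EE}}$ at level $1-\alpha$: $\ \lim_{n\to\infty}\sup_{\theta\in\Theta_{\mathrm{EE}}}\big|\mathbb P_\theta\big(\theta_1\in\mathrm{CI}_n(\widehat\sigma)\big)-(1-\alpha)\big|=0$ (the supremum over an empty class being $0$). -/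

import Mathlib

open MeasureTheory ProbabilityTheory Filter Topology

noncomputable section

/-- The ambient set of pairs `θ = (θ₁, P)`: a location and the distribution of the noise. -/
abbrev LocParam : Type := ℝ × ProbabilityMeasure ℝ

/-- The distribution `P_θ` of an observation `ξ = θ₁ + V`, where `V ∼ P`. -/
def obsLaw (θ : LocParam) : Measure ℝ := (θ.2 : Measure ℝ).map (fun v => θ.1 + v)

instance obsLaw_isProbabilityMeasure (θ : LocParam) : IsProbabilityMeasure (obsLaw θ) :=
  Measure.isProbabilityMeasure_map (by fun_prop)

/-- The joint distribution of an i.i.d. sample of size `n` from `P_θ`. -/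
def sampleLaw (n : ℕ) (θ : LocParam) : Measure (Fin n → ℝ) :=
  Measure.pi (fun _ => obsLaw θ)

/-- The parameter space `Θ`: the noise is centered with finite non-zero second moment.
A probability measure with finite second moment has a finite first moment, so the Bochner integral
below is a genuine expectation. -/
def paramSpace : Set LocParam :=
  {θ | ∫ x, x ∂(θ.2 : Measure ℝ) = 0 ∧
    0 < ∫⁻ x, ENNReal.ofReal (x ^ 2) ∂(θ.2 : Measure ℝ) ∧
    ∫⁻ x, ENNReal.ofReal (x ^ 2) ∂(θ.2 : Measure ℝ) < ⊤}

/-- The expectation `E_θ[ξ]`. -/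
def obsMean (θ : LocParam) : ℝ := ∫ x, x ∂(obsLaw θ)

/-- The standard deviation `σ(θ)`. -/
def obsSd (θ : LocParam) : ℝ := √(variance (fun x : ℝ => x) (obsLaw θ))

/-- The skewness `λ₃(θ)`. -/
def obsSkewness (θ : LocParam) : ℝ :=
  ∫ x, (x - obsMean θ) ^ 3 / obsSd θ ^ 3 ∂(obsLaw θ)

/-- The kurtosis `K₄(θ)`, as an element of `[0, ∞]` (it is `∞` if the fourth moment is infinite). -/
def obsKurtosis (θ : LocParam) : ENNReal :=
  ∫⁻ x, ENNReal.ofReal ((x - obsMean θ) ^ 4 / obsSd θ ^ 4) ∂(obsLaw θ)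

/-- The bounded-kurtosis class `Θ_EE = {θ ∈ Θ : K₄(θ) ≤ K}`. -/
def paramSpaceEE (K : ℝ) : Set LocParam :=
  {θ ∈ paramSpace | obsKurtosis θ ≤ ENNReal.ofReal K}

/-- The standard normal distribution function `Φ`. -/
def stdNormalCDF (x : ℝ) : ℝ := cdf (gaussianReal 0 1) x

/-- The standard normal density `φ`. -/
def stdNormalPDF (x : ℝ) : ℝ := gaussianPDFReal 0 1 x

/-- The standard normal quantile of order `τ` (meaningful for `0 < τ < 1`). -/
def stdNormalQuantile (τ : ℝ) : ℝ := sInf {x : ℝ | τ ≤ stdNormalCDF x}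

/-- The standardized sum `S_n = ∑ (ξ_i - E_θ[ξ]) / (σ(θ) √n)`. -/
def stdSum (n : ℕ) (θ : LocParam) (ξ : Fin n → ℝ) : ℝ :=
  (∑ i, (ξ i - obsMean θ)) / (obsSd θ * √(n : ℝ))

/-- The Berry-Esseen distance `Δ_{n,B}(θ)`. -/
def deltaB (n : ℕ) (θ : LocParam) : ℝ :=
  ⨆ x : ℝ, |(sampleLaw n θ).real {ξ | stdSum n θ ξ ≤ x} - stdNormalCDF x|

/-- The first-order Edgeworth distance `Δ_{n,E}(θ)`. -/
def deltaE (n : ℕ) (θ : LocParam) : ℝ :=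
  ⨆ x : ℝ, |(sampleLaw n θ).real {ξ | stdSum n θ ξ ≤ x} - stdNormalCDF x
    - obsSkewness θ / (6 * √(n : ℝ)) * (1 - x ^ 2) * stdNormalPDF x|

/-- The sample mean. -/
def sampleMean {n : ℕ} (ξ : Fin n → ℝ) : ℝ := (∑ i, ξ i) / n

/-- The empirical standard deviation `σ̂` (with normalization `1 / n`). -/
def sampleSd {n : ℕ} (ξ : Fin n → ℝ) : ℝ := √((∑ i, (ξ i - sampleMean ξ) ^ 2) / n)

/-- The term `ν_n^Var(a) = exp (-n (1 - 1/a)² / (2K))`. -/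
def nuVar (K : ℝ) (n : ℕ) (a : ℝ) : ℝ :=
  Real.exp (-((n : ℝ) * (1 - 1 / a) ^ 2 / (2 * K)))

/-- The modified order `1 - α/2 + δ_n + ν_n^Var / 2` of the normal quantile. -/
def quantileOrder (α K : ℝ) (δ a : ℕ → ℝ) (n : ℕ) : ℝ :=
  1 - α / 2 + δ n + nuVar K n (a n) / 2

/-- The enlargement factor `C_n`. -/
def enlargement (α K : ℝ) (δ a : ℕ → ℝ) (n : ℕ) : ℝ :=
  (1 / a n - 1 / (n : ℝ) * stdNormalQuantile (quantileOrder α K δ a n) ^ 2) ^ (-(1 / 2) : ℝ)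

open Classical in
/-- The confidence interval for the expectation with unknown variance, at level `1 - α`. -/
def ciSigmaHat (α K : ℝ) (δ a : ℕ → ℝ) (n : ℕ) (ξ : Fin n → ℝ) : Set ℝ :=
  if quantileOrder α K δ a n < stdNormalCDF (√((n : ℝ) / a n)) then
    Set.Icc
      (sampleMean ξ - sampleSd ξ / √(n : ℝ) * enlargement α K δ a n
        * stdNormalQuantile (quantileOrder α K δ a n))
      (sampleMean ξ + sampleSd ξ / √(n : ℝ) * enlargement α K δ a n
        * stdNormalQuantile (quantileOrder α K δ a n))
  else Set.univ

/-- The probability under `P_θ^{⊗n}` that the confidence set `CS n` contains `θ₁`. -/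
def coverage (CS : (n : ℕ) → (Fin n → ℝ) → Set ℝ) (n : ℕ) (θ : LocParam) : ℝ :=
  (sampleLaw n θ).real {ξ | θ.1 ∈ CS n ξ}

/-- Pointwise asymptotic exactness over `S` at level `1 - α`. -/
def AsympExactPointwise (CS : (n : ℕ) → (Fin n → ℝ) → Set ℝ) (S : Set LocParam) (α : ℝ) : Prop :=
  ∀ θ ∈ S, Tendsto (fun n => coverage CS n θ) atTop (𝓝 (1 - α))

/-- Uniform asymptotic exactness over `S` at level `1 - α`. The family under the supremum is
bounded, and the supremum over an empty `S` is `0`. -/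
def AsympExactUniform (CS : (n : ℕ) → (Fin n → ℝ) → Set ℝ) (S : Set LocParam) (α : ℝ) : Prop :=
  Tendsto (fun n => ⨆ θ : S, |coverage CS n (θ : LocParam) - (1 - α)|) atTop (𝓝 0)

end

/-! Once the bounded branch of the interval is taken, `θ₁` is covered exactly when `|S_n| ≤ (σ̂/σ) ·
C_n q(τ_n)` (`coverage_ciSigmaHat`). The factor `C_n q(τ_n)` is deterministic and free of `θ`. Since
`b_n √n → ∞`, `ν_n` vanishes, so `τ_n → 1 - α/2`, `C_n → 1`, and the bounded branch is eventually
taken. By Slutsky (`tendsto_measureReal_abs_le_mul`) it remains to know that `S_n` is asymptotically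
standard normal and that the empirical mean of the squared standardized observations tends to `1` in
probability. `tendsto_coverage_ciSigmaHat` says this along an arbitrary sequence `θ_n`, which serves
both claims. For fixed `θ`, the two inputs are the central limit theorem and the weak law. For the
uniform claim, `asympExactUniform_of_forall_seq` reduces the supremum to sequences in the
bounded-kurtosis class. There Chebyshev gives the second input, and the bound on `δ_n` gives the
first, because bounded kurtosis bounds the skewness and makes the Edgeworth correction
`O(n^{-1/2})`. -/

/-! ### The normal distribution function and its quantiles. -/

lemma stdNormalCDF_eq_measureReal (x : ℝ) :
    stdNormalCDF x = (gaussianReal 0 1).real (Set.Iic x) := cdf_eq_real _ _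

lemma stdNormalCDF_mem_Icc (x : ℝ) : stdNormalCDF x ∈ Set.Icc (0 : ℝ) 1 :=
  ⟨cdf_nonneg _ _, cdf_le_one _ _⟩

lemma strictMono_stdNormalCDF : StrictMono stdNormalCDF := by
  intro x y hxy
  have hpos : 0 < (gaussianReal 0 1).real (Set.Ioc x y) := by
    rw [measureReal_def, gaussianReal_apply_eq_integral 0 one_ne_zero, ENNReal.toReal_ofReal']
    refine lt_max_of_lt_left ?_
    rw [← intervalIntegral.integral_of_le hxy.le]
    exact intervalIntegral.intervalIntegral_pos_of_pos
      (integrable_gaussianPDFReal 0 1).intervalIntegrable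
      (fun t => gaussianPDFReal_pos 0 1 t one_ne_zero) hxy
  rw [stdNormalCDF_eq_measureReal, stdNormalCDF_eq_measureReal, ← Set.Iic_union_Ioc_eq_Iic hxy.le,
    measureReal_union (Set.Iic_disjoint_Ioc le_rfl) measurableSet_Ioc]
  linarith

lemma continuous_stdNormalCDF : Continuous stdNormalCDF := by
  have := nullSingletonClass_gaussianReal (μ := 0) (v := 1) one_ne_zero
  have h : stdNormalCDF = fun x => (∫ t in (0 : ℝ)..x, gaussianPDFReal 0 1 t) + stdNormalCDF 0 := by
    funext x
    have h1 (y : ℝ) : stdNormalCDF y = ∫ t in Set.Iic y, gaussianPDFReal 0 1 t := by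
      rw [stdNormalCDF_eq_measureReal, measureReal_def,
        gaussianReal_apply_eq_integral 0 one_ne_zero, ENNReal.toReal_ofReal]
      exact integral_nonneg fun t => gaussianPDFReal_nonneg 0 1 t
    rw [h1, h1, intervalIntegral.integral_Iic_sub_Iic
      (integrable_gaussianPDFReal 0 1).integrableOn
      (integrable_gaussianPDFReal 0 1).integrableOn |>.symm]
    ring
  rw [h]
  exact (intervalIntegral.continuous_primitive
    (fun _ _ => (integrable_gaussianPDFReal 0 1).intervalIntegrable) 0).add continuous_const

lemma stdNormalCDF_neg (x : ℝ) : stdNormalCDF (-x) = 1 - stdNormalCDF x := by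
  have := nullSingletonClass_gaussianReal (μ := 0) (v := 1) one_ne_zero
  have h : (gaussianReal 0 1).map (fun y => -y) = gaussianReal 0 1 := by
    rw [gaussianReal_map_neg, neg_zero]
  rw [stdNormalCDF_eq_measureReal, stdNormalCDF_eq_measureReal,
    ← probReal_compl_eq_one_sub measurableSet_Iic, Set.compl_Iic]
  conv_lhs => rw [← h]
  rw [map_measureReal_apply measurable_neg measurableSet_Iic]
  have : (fun y : ℝ => -y) ⁻¹' Set.Iic (-x) = Set.Ici x := by ext; simp
  rw [this]
  exact measureReal_congr Ioi_ae_eq_Ici.symm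

lemma exists_stdNormalCDF_eq {τ : ℝ} (h0 : 0 < τ) (h1 : τ < 1) : ∃ z, stdNormalCDF z = τ := by
  obtain ⟨x, hx⟩ := ((tendsto_cdf_atBot (gaussianReal 0 1)).eventually_lt_const h0).exists
  obtain ⟨y, hy⟩ := ((tendsto_cdf_atTop (gaussianReal 0 1)).eventually_const_lt h1).exists
  exact mem_range_of_exists_le_of_exists_ge continuous_stdNormalCDF ⟨x, hx.le⟩ ⟨y, hy.le⟩

lemma tendsto_stdNormalQuantile {ι : Type*} {l : Filter ι} {τ : ι → ℝ} {z : ℝ}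
    (h : Tendsto τ l (𝓝 (stdNormalCDF z))) :
    Tendsto (fun i => stdNormalQuantile (τ i)) l (𝓝 z) := by
  rw [tendsto_order]
  constructor
  · intro y hy
    obtain ⟨w, hyw, hwz⟩ := exists_between hy
    -- `u` only witnesses that the set under `sInf` is nonempty; the infimum of an empty set would
    -- be the default `0`. In the other half `u < z` supplies the lower bound.
    obtain ⟨u, hu⟩ := exists_gt z
    filter_upwards [h.eventually_const_lt (strictMono_stdNormalCDF hwz),
      h.eventually_lt_const (strictMono_stdNormalCDF hu)] with i hi hi'
    refine hyw.trans_le (le_csInf ⟨u, hi'.le⟩ fun x hx => ?_)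
    exact (strictMono_stdNormalCDF.lt_iff_lt.1 (hi.trans_le hx)).le
  · intro y hy
    obtain ⟨w, hzw, hwy⟩ := exists_between hy
    obtain ⟨u, hu⟩ := exists_lt z
    filter_upwards [h.eventually_const_lt (strictMono_stdNormalCDF hu),
      h.eventually_lt_const (strictMono_stdNormalCDF hzw)] with i hi hi'
    refine lt_of_le_of_lt (csInf_le ⟨u, fun x hx => ?_⟩ (show τ i ≤ stdNormalCDF w from hi'.le)) hwy
    exact (strictMono_stdNormalCDF.lt_iff_lt.1 (hi.trans_le hx)).le

/-- The inequality `1 + x²/2 ≤ exp (x²/2)` lets the Gaussian factor absorb the polynomial. -/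
lemma abs_one_sub_sq_mul_stdNormalPDF_le (x : ℝ) : |(1 - x ^ 2) * stdNormalPDF x| ≤ 2 := by
  have hφ : stdNormalPDF x ≤ Real.exp (-(x ^ 2 / 2)) := by
    have h1 : (1 : ℝ) ≤ √(2 * Real.pi * 1) := by
      rw [Real.one_le_sqrt]; linarith [Real.pi_gt_three]
    simp only [stdNormalPDF, gaussianPDFReal, NNReal.coe_one, sub_zero]
    rw [show -x ^ 2 / (2 * 1) = -(x ^ 2 / 2) by ring]
    exact mul_le_of_le_one_left (Real.exp_pos _).le (inv_le_one_of_one_le₀ h1)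
  have h2 : |1 - x ^ 2| ≤ 2 * Real.exp (x ^ 2 / 2) := by
    have := Real.add_one_le_exp (x ^ 2 / 2)
    rw [abs_le]; constructor <;> nlinarith [sq_nonneg x]
  have h0 : 0 ≤ stdNormalPDF x := gaussianPDFReal_nonneg 0 1 x
  rw [abs_mul, abs_of_nonneg h0]
  calc |1 - x ^ 2| * stdNormalPDF x
      ≤ 2 * Real.exp (x ^ 2 / 2) * Real.exp (-(x ^ 2 / 2)) :=
        mul_le_mul h2 hφ h0 (by positivity)
    _ = 2 := by rw [mul_assoc, ← Real.exp_add]; simp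

/-! ### Limits of the deterministic constants. -/

section Parameters

variable {α K : ℝ} {δ a : ℕ → ℝ}

lemma tendsto_nuVar (hK : 0 < K) (ha : Tendsto a atTop (𝓝 1))
    (han : Tendsto (fun n : ℕ => (a n - 1) * √(n : ℝ)) atTop atTop) :
    Tendsto (fun n => nuVar K n (a n)) atTop (𝓝 0) := by
  refine Real.tendsto_exp_neg_atTop_nhds_zero.comp (Tendsto.atTop_div_const (by positivity) ?_)
  -- The exponent is a square: `n (1 - 1/a)² = ((a - 1) √n / a)²`.
  have h : Tendsto (fun n : ℕ => ((a n - 1) * √(n : ℝ) * (a n)⁻¹) ^ 2) atTop atTop :=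
    (tendsto_pow_atTop two_ne_zero).comp
      (han.atTop_mul_pos one_pos (by simpa using ha.inv₀ one_ne_zero))
  refine h.congr' ?_
  filter_upwards [ha.eventually_ne one_ne_zero] with n hn
  rw [mul_pow, mul_pow, Real.sq_sqrt n.cast_nonneg]
  field_simp

lemma tendsto_quantileOrder (hδ0 : Tendsto δ atTop (𝓝 0)) (hK : 0 < K)
    (ha : Tendsto a atTop (𝓝 1))
    (han : Tendsto (fun n : ℕ => (a n - 1) * √(n : ℝ)) atTop atTop) :
    Tendsto (quantileOrder α K δ a) atTop (𝓝 (1 - α / 2)) := by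
  have := ((tendsto_const_nhds (x := 1 - α / 2)).add hδ0).add
    ((tendsto_nuVar hK ha han).div_const 2)
  simp only [add_zero, zero_div] at this
  exact this

/-- The left side tends to `1 - α/2 < 1` while the right side tends to `1`, so the interval is
eventually not the whole line. -/
lemma eventually_quantileOrder_lt (hα : 0 < α) (ha : Tendsto a atTop (𝓝 1))
    (hτ : Tendsto (quantileOrder α K δ a) atTop (𝓝 (1 - α / 2))) :
    ∀ᶠ n in atTop, quantileOrder α K δ a n < stdNormalCDF (√((n : ℝ) / a n)) := by
  have h1 : Tendsto (fun n : ℕ => √((n : ℝ) / a n)) atTop atTop := by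
    refine Real.tendsto_sqrt_atTop.comp ?_
    exact tendsto_natCast_atTop_atTop.atTop_mul_pos one_pos (by simpa using ha.inv₀ one_ne_zero)
  exact hτ.eventually_lt ((tendsto_cdf_atTop (gaussianReal 0 1)).comp h1) (by linarith)

lemma tendsto_enlargement_mul_quantile {z : ℝ} (ha : Tendsto a atTop (𝓝 1))
    (hτ : Tendsto (quantileOrder α K δ a) atTop (𝓝 (stdNormalCDF z))) :
    Tendsto (fun n => enlargement α K δ a n * stdNormalQuantile (quantileOrder α K δ a n))
      atTop (𝓝 z) := by
  have hq := tendsto_stdNormalQuantile hτ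
  have h1 : Tendsto (fun n : ℕ => 1 / a n - 1 / (n : ℝ) *
      stdNormalQuantile (quantileOrder α K δ a n) ^ 2) atTop (𝓝 1) := by
    have := (ha.inv₀ one_ne_zero).sub
      (tendsto_one_div_atTop_nhds_zero_nat.mul (hq.pow 2))
    simpa using this
  have h2 := h1.rpow_const (p := (-(1 / 2) : ℝ)) (Or.inl one_ne_zero)
  simpa [enlargement] using h2.mul hq

end Parameters

/-! ### Slutsky's theorem along varying probability spaces. -/

section GeneralProbability

variable {Ω : ℕ → Type*} [∀ n, MeasurableSpace (Ω n)] {P : ∀ n, Measure (Ω n)}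
  [∀ n, IsProbabilityMeasure (P n)] {S R : ∀ n, Ω n → ℝ}

/-- Continuity of the limit makes atoms at `x` asymptotically negligible; this handles the left
endpoint of `[-r, r]`. -/
lemma tendsto_measureReal_lt_of_tendsto_le {F : ℝ → ℝ} (hF : Continuous F)
    (h : ∀ x, Tendsto (fun n => (P n).real {ω | S n ω ≤ x}) atTop (𝓝 (F x))) (x : ℝ) :
    Tendsto (fun n => (P n).real {ω | S n ω < x}) atTop (𝓝 (F x)) := by
  rw [tendsto_order]
  constructor
  · intro c hc
    have h1 : ∀ᶠ y in 𝓝[<] x, c < F y :=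
      (hF.continuousAt.eventually_const_lt hc).filter_mono nhdsWithin_le_nhds
    obtain ⟨y, hy, hyx⟩ := (h1.and self_mem_nhdsWithin).exists
    filter_upwards [(h y).eventually_const_lt hy] with n hn
    exact hn.trans_le (measureReal_mono fun ω hω => lt_of_le_of_lt hω hyx)
  · intro c hc
    filter_upwards [(h x).eventually_lt_const hc] with n hn
    exact (measureReal_mono fun ω (hω : S n ω < x) => hω.le).trans_lt hn

lemma tendsto_measureReal_abs_le (hS : ∀ n, Measurable (S n))
    (h : ∀ x, Tendsto (fun n => (P n).real {ω | S n ω ≤ x}) atTop (𝓝 (stdNormalCDF x)))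
    {r : ℝ} (hr : 0 ≤ r) :
    Tendsto (fun n => (P n).real {ω | |S n ω| ≤ r}) atTop (𝓝 (2 * stdNormalCDF r - 1)) := by
  have key := (h r).sub (tendsto_measureReal_lt_of_tendsto_le continuous_stdNormalCDF h (-r))
  rw [stdNormalCDF_neg, show stdNormalCDF r - (1 - stdNormalCDF r) = 2 * stdNormalCDF r - 1 by
    ring] at key
  refine key.congr fun n => ?_
  have hsub : {ω | S n ω < -r} ⊆ {ω | S n ω ≤ r} := fun ω (hω : S n ω < -r) =>
    show S n ω ≤ r by linarith
  rw [← measureReal_sdiff hsub (measurableSet_lt (hS n) measurable_const)]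
  congr 1
  ext ω
  simp only [Set.mem_sdiff, Set.mem_ofPred_eq, not_lt, abs_le]
  tauto

/-- A Slutsky-type result along a sequence of probability spaces. -/
lemma tendsto_measureReal_abs_le_mul (hS : ∀ n, Measurable (S n))
    (h : ∀ x, Tendsto (fun n => (P n).real {ω | S n ω ≤ x}) atTop (𝓝 (stdNormalCDF x)))
    (hR : ∀ η : ℝ, 0 < η → Tendsto (fun n => (P n).real {ω | η ≤ |R n ω - 1|}) atTop (𝓝 0))
    {t : ℕ → ℝ} {z : ℝ} (hz : 0 < z) (ht : Tendsto t atTop (𝓝 z)) :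
    Tendsto (fun n => (P n).real {ω | |S n ω| ≤ R n ω * t n}) atTop
      (𝓝 (2 * stdNormalCDF z - 1)) := by
  have hc : Continuous fun r => 2 * stdNormalCDF r - 1 := by
    have := continuous_stdNormalCDF; fun_prop
  rw [tendsto_order]
  constructor
  · intro c hcz
    have h1 : ∀ᶠ r in 𝓝[<] z, c < 2 * stdNormalCDF r - 1 ∧ 0 < r :=
      ((hc.continuousAt.eventually_const_lt hcz).and (lt_mem_nhds hz)).filter_mono
        nhdsWithin_le_nhds
    obtain ⟨r, ⟨hr, hr0⟩, hrz : r < z⟩ := (h1.and self_mem_nhdsWithin).exists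
    -- With this `η`, `(1 - η) z` is the midpoint of `r` and `z`, so `(1 - η) t n` eventually
    -- exceeds `r`.
    have hη : 0 < (z - r) / (2 * z) := div_pos (by linarith) (by linarith)
    have ht' : ∀ᶠ n in atTop, r < (1 - (z - r) / (2 * z)) * t n := by
      refine (ht.const_mul _).eventually_const_lt ?_
      have : (1 - (z - r) / (2 * z)) * z = (z + r) / 2 := by field_simp; ring
      linarith
    have h2 := (tendsto_measureReal_abs_le hS h hr0.le).sub (hR _ hη)
    rw [sub_zero] at h2
    filter_upwards [h2.eventually_const_lt hr, ht', ht.eventually_const_lt hz] with n hn hn1 hn2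
    have hsub : {ω | |S n ω| ≤ r} ⊆
        {ω | |S n ω| ≤ R n ω * t n} ∪ {ω | (z - r) / (2 * z) ≤ |R n ω - 1|} := by
      intro ω hω
      by_contra! hcon
      simp only [Set.mem_union, Set.mem_ofPred_eq, not_or, not_le] at hcon hω
      have h3 := (abs_lt.1 hcon.2).1
      have : (1 - (z - r) / (2 * z)) * t n ≤ R n ω * t n := by gcongr; linarith
      linarith
    have := (measureReal_mono (μ := P n) hsub).trans (measureReal_union_le _ _)
    linarith
  · intro c hcz
    have h1 : ∀ᶠ r in 𝓝[>] z, 2 * stdNormalCDF r - 1 < c :=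
      (hc.continuousAt.eventually_lt_const hcz).filter_mono nhdsWithin_le_nhds
    obtain ⟨r, hr, hrz : z < r⟩ := (h1.and self_mem_nhdsWithin).exists
    -- Here `(1 + η) z` is the midpoint of `z` and `r`.
    have hη : 0 < (r - z) / (2 * z) := div_pos (by linarith) (by linarith)
    have ht' : ∀ᶠ n in atTop, (1 + (r - z) / (2 * z)) * t n < r := by
      refine (ht.const_mul _).eventually_lt_const ?_
      have : (1 + (r - z) / (2 * z)) * z = (z + r) / 2 := by field_simp; ring
      linarith
    have h2 := (tendsto_measureReal_abs_le hS h (hz.trans hrz).le).add (hR _ hη)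
    rw [add_zero] at h2
    filter_upwards [h2.eventually_lt_const hr, ht', ht.eventually_const_lt hz] with n hn hn1 hn2
    have hsub : {ω | |S n ω| ≤ R n ω * t n} ⊆
        {ω | |S n ω| ≤ r} ∪ {ω | (r - z) / (2 * z) ≤ |R n ω - 1|} := by
      intro ω hω
      by_contra! hcon
      simp only [Set.mem_union, Set.mem_ofPred_eq, not_or, not_le] at hcon hω
      have h3 := (abs_lt.1 hcon.2).2
      have : R n ω * t n ≤ (1 + (r - z) / (2 * z)) * t n := by gcongr; linarith
      linarith
    have := (measureReal_mono (μ := P n) hsub).trans (measureReal_union_le _ _)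
    linarith

end GeneralProbability

/-! ### Chebyshev, weak law and central limit theorem for finite samples. -/

section ProductMeasure

variable {μ : Measure ℝ} [IsProbabilityMeasure μ] {f : ℝ → ℝ}

/-- Chebyshev's inequality for the empirical average of an i.i.d. sample. -/
lemma measureReal_pi_average_sub_ge_le (hf : MemLp f 2 μ) {n : ℕ} (hn : 1 ≤ n) {η : ℝ}
    (hη : 0 < η) :
    (Measure.pi fun _ : Fin n => μ).real {x | η ≤ |(∑ i, f (x i)) / n - ∫ y, f y ∂μ|} ≤
      Var[f; μ] / (n * η ^ 2) := by
  have hn0 : (0 : ℝ) < n := by exact_mod_cast hn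
  set Q := Measure.pi fun _ : Fin n => μ
  have hmem (i : Fin n) : MemLp (fun x : Fin n → ℝ => f (x i)) 2 Q :=
    hf.comp_measurePreserving (measurePreserving_eval (fun _ : Fin n => μ) i)
  have hsum : MemLp (∑ i, fun x : Fin n → ℝ => f (x i)) 2 Q :=
    memLp_finsetSum' _ fun i _ => hmem i
  have hmean : Q[∑ i, fun x : Fin n → ℝ => f (x i)] = n * ∫ y, f y ∂μ := by
    simp only [Finset.sum_apply]
    rw [integral_finsetSum _ fun i _ => (hmem i).integrable one_le_two]
    have (i : Fin n) : ∫ x, f (x i) ∂Q = ∫ y, f y ∂μ :=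
      integral_comp_eval (μ := fun _ : Fin n => μ) (i := i) hf.aestronglyMeasurable
    simp [this]
  have hvar : Var[∑ i, fun x : Fin n → ℝ => f (x i); Q] = n * Var[f; μ] := by
    rw [variance_sum_pi (μ := fun _ : Fin n => μ) (X := fun _ => f) fun _ => hf]
    simp
  have key := meas_ge_le_variance_div_sq hsum (mul_pos hn0 hη)
  rw [hmean, hvar] at key
  have hset : {x : Fin n → ℝ | η ≤ |(∑ i, f (x i)) / n - ∫ y, f y ∂μ|} =
      {x | n * η ≤ |(∑ i, fun x : Fin n → ℝ => f (x i)) x - n * ∫ y, f y ∂μ|} := by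
    ext x
    have : (∑ i, f (x i)) - n * ∫ y, f y ∂μ = n * ((∑ i, f (x i)) / n - ∫ y, f y ∂μ) := by
      field_simp
    simp only [Set.mem_ofPred_eq, Finset.sum_apply]
    rw [this, abs_mul, abs_of_pos hn0, mul_le_mul_iff_right₀ hn0]
  rw [hset, measureReal_def]
  refine (ENNReal.toReal_mono ENNReal.ofReal_ne_top key).trans_eq ?_
  have hv := variance_nonneg f μ
  rw [ENNReal.toReal_ofReal (by positivity)]
  field_simp

/-- Transfers limit theorems for one infinite i.i.d. sequence to the finite product measures, which
live on different spaces as `n` varies. -/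
lemma infinitePi_map_fin (n : ℕ) :
    (Measure.infinitePi fun _ : ℕ => μ).map (fun ω (i : Fin n) => ω i) =
      Measure.pi fun _ : Fin n => μ := by
  rw [Measure.map_infinitePi_infinitePi_of_inj (P := fun _ : ℕ => μ) Fin.val_injective,
    Measure.infinitePi_eq_pi]

lemma identDistrib_infinitePi_eval (hf : Measurable f) (i : ℕ) :
    IdentDistrib (fun ω : ℕ → ℝ => f (ω i)) (fun ω : ℕ → ℝ => f (ω 0))
      (Measure.infinitePi fun _ : ℕ => μ) (Measure.infinitePi fun _ : ℕ => μ) := by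
  refine IdentDistrib.comp (f := fun ω : ℕ → ℝ => ω i) (g := fun ω : ℕ → ℝ => ω 0)
    ⟨(measurable_pi_apply i).aemeasurable, (measurable_pi_apply 0).aemeasurable, ?_⟩ hf
  rw [Measure.infinitePi_map_eval (fun _ : ℕ => μ), Measure.infinitePi_map_eval (fun _ : ℕ => μ)]

/-- The weak law of large numbers for finite product measures. -/
lemma tendsto_measureReal_pi_average_sub_ge (hfm : Measurable f) (hf : Integrable f μ) {η : ℝ}
    (hη : 0 < η) :
    Tendsto (fun n : ℕ => (Measure.pi fun _ : Fin n => μ).real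
      {x | η ≤ |(∑ i, f (x i)) / n - ∫ y, f y ∂μ|}) atTop (𝓝 0) := by
  set Q := Measure.infinitePi fun _ : ℕ => μ
  have hmp : MeasurePreserving (fun ω : ℕ → ℝ => ω 0) Q μ :=
    measurePreserving_eval_infinitePi (fun _ : ℕ => μ) 0
  have hmean : ∫ ω, f (ω 0) ∂Q = ∫ y, f y ∂μ := by
    rw [← hmp.map_eq, integral_map hmp.aemeasurable hfm.aestronglyMeasurable]
  have hlaw := strong_law_ae_real (μ := Q) (fun i ω => f (ω i)) (hmp.integrable_comp_of_integrable hf)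
    (fun i j hij => (iIndepFun_infinitePi (P := fun _ : ℕ => μ) (X := fun _ => f)
      fun _ => hfm).indepFun hij) (identDistrib_infinitePi_eval hfm)
  rw [hmean] at hlaw
  have hprob := tendstoInMeasure_of_tendsto_ae (fun n => Measurable.aestronglyMeasurable
    (by fun_prop)) hlaw
  have h1 := (ENNReal.tendsto_toReal ENNReal.zero_ne_top).comp
    (tendstoInMeasure_iff_norm.1 hprob η hη)
  refine h1.congr fun n => ?_
  rw [← infinitePi_map_fin, map_measureReal_apply (by fun_prop)
    (measurableSet_le (by fun_prop) (by fun_prop))]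
  simp only [Function.comp_apply, measureReal_def, Real.norm_eq_abs, Set.preimage_ofPred_eq,
    Finset.sum_range]
  rfl

/-- The central limit theorem for finite product measures. -/
lemma tendsto_measureReal_pi_sum_le (hfm : Measurable f) (h0 : ∫ y, f y ∂μ = 0)
    (h1 : ∫ y, f y ^ 2 ∂μ = 1) (x : ℝ) :
    Tendsto (fun n : ℕ => (Measure.pi fun _ : Fin n => μ).real
      {ξ | (√(n : ℝ))⁻¹ * ∑ i, f (ξ i) ≤ x}) atTop (𝓝 (stdNormalCDF x)) := by
  set Q := Measure.infinitePi fun _ : ℕ => μ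
  have hmp : MeasurePreserving (fun ω : ℕ → ℝ => ω 0) Q μ :=
    measurePreserving_eval_infinitePi (fun _ : ℕ => μ) 0
  have hmean {g : ℝ → ℝ} (hg : Measurable g) : ∫ ω, g (ω 0) ∂Q = ∫ y, g y ∂μ := by
    rw [← hmp.map_eq, integral_map hmp.aemeasurable hg.aestronglyMeasurable]
  have hclt := tendstoInDistribution_inv_sqrt_mul_sum (P := Q) (P' := gaussianReal 0 1)
    (Y := id) (X := fun i ω => f (ω i)) HasLaw.id ((hmean hfm).trans h0)
    ((hmean (hfm.pow_const 2)).trans h1)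
    (iIndepFun_infinitePi (P := fun _ : ℕ => μ) (X := fun _ => f) fun _ => hfm)
    (identDistrib_infinitePi_eval hfm)
  have := nullSingletonClass_gaussianReal (μ := 0) (v := 1) one_ne_zero
  -- Portmanteau: the frontier of `Set.Iic x` is a single point, null for the Gaussian.
  have key := ProbabilityMeasure.tendsto_measure_of_null_frontier_of_tendsto' hclt.tendsto
    (E := Set.Iic x) (by simp)
  simp only [ProbabilityMeasure.coe_mk, Measure.map_id] at key
  have h2 := (ENNReal.tendsto_toReal (measure_ne_top _ _)).comp key
  rw [stdNormalCDF_eq_measureReal]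
  refine h2.congr fun n => ?_
  rw [← infinitePi_map_fin, map_measureReal_apply (by fun_prop)
    (measurableSet_le (by fun_prop) (by fun_prop))]
  simp only [Function.comp_apply, measureReal_def]
  rw [Measure.map_apply (by fun_prop) measurableSet_Iic]
  simp only [Finset.sum_range]
  rfl

end ProductMeasure

/-- The standardized observation. -/
noncomputable def stdObs (θ : LocParam) (x : ℝ) : ℝ := (x - obsMean θ) / obsSd θ

@[fun_prop]
lemma measurable_stdObs (θ : LocParam) : Measurable (stdObs θ) := by
  unfold stdObs; fun_prop

@[fun_prop]
lemma measurable_stdSum (n : ℕ) (θ : LocParam) : Measurable (stdSum n θ) := by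
  unfold stdSum; fun_prop

instance sampleLaw_isProbabilityMeasure (n : ℕ) (θ : LocParam) :
    IsProbabilityMeasure (sampleLaw n θ) := by
  unfold sampleLaw; infer_instance

/-! ### Moments of the standardized observation. -/

section Moments

variable {θ : LocParam}

lemma memLp_two_id_of_mem_paramSpace (hθ : θ ∈ paramSpace) :
    MemLp (fun x : ℝ => x) 2 (θ.2 : Measure ℝ) := by
  rw [memLp_two_iff_integrable_sq (by fun_prop)]
  refine ⟨by fun_prop, ?_⟩
  rw [hasFiniteIntegral_iff_ofReal (ae_of_all _ fun x => sq_nonneg x)]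
  exact hθ.2.2

lemma obsMean_eq (hθ : θ ∈ paramSpace) : obsMean θ = θ.1 := by
  have hi := (memLp_two_id_of_mem_paramSpace hθ).integrable one_le_two
  rw [obsMean, obsLaw, integral_map (by fun_prop) (by fun_prop),
    integral_add (integrable_const _) hi, hθ.1]
  simp

lemma memLp_two_id_obsLaw (hθ : θ ∈ paramSpace) : MemLp (fun x : ℝ => x) 2 (obsLaw θ) := by
  rw [obsLaw, memLp_map_measure_iff (by fun_prop) (by fun_prop)]
  exact (memLp_const θ.1).add (memLp_two_id_of_mem_paramSpace hθ)

lemma variance_obsLaw_pos (hθ : θ ∈ paramSpace) : 0 < Var[fun x : ℝ => x; obsLaw θ] := by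
  have hm := memLp_two_id_of_mem_paramSpace hθ
  rw [obsLaw, variance_map (by fun_prop) (by fun_prop)]
  simp only [Function.comp_def]
  rw [variance_const_add hm.aestronglyMeasurable,
    variance_of_integral_eq_zero (by fun_prop) hθ.1,
    integral_eq_lintegral_of_nonneg_ae (ae_of_all _ fun x => sq_nonneg x) (by fun_prop)]
  exact ENNReal.toReal_pos hθ.2.1.ne' hθ.2.2.ne

lemma obsSd_pos (hθ : θ ∈ paramSpace) : 0 < obsSd θ := Real.sqrt_pos.2 (variance_obsLaw_pos hθ)

lemma memLp_two_stdObs (hθ : θ ∈ paramSpace) : MemLp (stdObs θ) 2 (obsLaw θ) := by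
  change MemLp (fun x => (x - obsMean θ) / obsSd θ) 2 (obsLaw θ)
  simp only [div_eq_mul_inv]
  exact ((memLp_two_id_obsLaw hθ).sub (memLp_const _)).mul_const _

lemma integral_stdObs (hθ : θ ∈ paramSpace) : ∫ x, stdObs θ x ∂(obsLaw θ) = 0 := by
  have hi := (memLp_two_id_obsLaw hθ).integrable one_le_two
  simp only [stdObs]
  rw [integral_div, integral_sub hi (integrable_const _)]
  simp [obsMean]

lemma integral_stdObs_sq (hθ : θ ∈ paramSpace) : ∫ x, stdObs θ x ^ 2 ∂(obsLaw θ) = 1 := by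
  have hv := variance_obsLaw_pos hθ
  simp only [stdObs, div_pow]
  rw [integral_div, obsSd, Real.sq_sqrt hv.le]
  have := variance_eq_integral (X := fun x : ℝ => x) (μ := obsLaw θ) (by fun_prop)
  rw [obsMean, ← this, div_self hv.ne']

lemma variance_stdObs (hθ : θ ∈ paramSpace) : Var[stdObs θ; obsLaw θ] = 1 := by
  rw [variance_of_integral_eq_zero (by fun_prop) (integral_stdObs hθ), integral_stdObs_sq hθ]

variable {K : ℝ}

lemma integrable_stdObs_pow_four (hθ : θ ∈ paramSpaceEE K) :
    Integrable (fun x => stdObs θ x ^ 4) (obsLaw θ) := by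
  refine ⟨by fun_prop, ?_⟩
  rw [hasFiniteIntegral_iff_ofReal (ae_of_all _ fun x => by positivity)]
  simp only [stdObs, div_pow]
  exact hθ.2.trans_lt ENNReal.ofReal_lt_top

lemma integral_stdObs_pow_four_le (hK : 0 < K) (hθ : θ ∈ paramSpaceEE K) :
    ∫ x, stdObs θ x ^ 4 ∂(obsLaw θ) ≤ K := by
  rw [integral_eq_lintegral_of_nonneg_ae (ae_of_all _ fun x => by positivity) (by fun_prop)]
  refine ENNReal.toReal_le_of_le_ofReal hK.le ?_
  simp only [stdObs, div_pow]
  exact hθ.2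

lemma variance_stdObs_sq_le (hK : 0 < K) (hθ : θ ∈ paramSpaceEE K) :
    Var[fun x => stdObs θ x ^ 2; obsLaw θ] ≤ K := by
  refine (variance_le_expectation_sq (by fun_prop)).trans ?_
  refine le_trans (le_of_eq ?_) (integral_stdObs_pow_four_le hK hθ)
  refine integral_congr_ae (ae_of_all _ fun x => ?_)
  simp only [Pi.pow_apply]
  ring

lemma memLp_two_stdObs_sq (hθ : θ ∈ paramSpaceEE K) :
    MemLp (fun x => stdObs θ x ^ 2) 2 (obsLaw θ) := by
  rw [memLp_two_iff_integrable_sq (by fun_prop)]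
  refine (integrable_stdObs_pow_four hθ).congr (ae_of_all _ fun x => ?_)
  ring

/-- Integrate `|t|³ ≤ (t² + t⁴)/2`, which comes from `t² (t ± 1)² ≥ 0`. -/
lemma abs_obsSkewness_le (hK : 0 < K) (hθ : θ ∈ paramSpaceEE K) :
    |obsSkewness θ| ≤ (1 + K) / 2 := by
  have h2 := (memLp_two_stdObs hθ.1).integrable_sq
  have h4 := integrable_stdObs_pow_four hθ
  calc |obsSkewness θ| = |∫ x, stdObs θ x ^ 3 ∂(obsLaw θ)| := by
        simp only [obsSkewness, stdObs, div_pow]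
    _ ≤ ∫ x, (stdObs θ x ^ 2 + stdObs θ x ^ 4) / 2 ∂(obsLaw θ) := by
        rw [← Real.norm_eq_abs]
        refine norm_integral_le_of_norm_le ((h2.add h4).div_const 2) (ae_of_all _ fun x => ?_)
        rw [Real.norm_eq_abs, abs_le]
        constructor <;>
          nlinarith [mul_nonneg (sq_nonneg (stdObs θ x)) (sq_nonneg (stdObs θ x - 1)),
            mul_nonneg (sq_nonneg (stdObs θ x)) (sq_nonneg (stdObs θ x + 1))]
    _ ≤ (1 + K) / 2 := by
        rw [integral_div, integral_add h2 h4, integral_stdObs_sq hθ.1]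
        linarith [integral_stdObs_pow_four_le hK hθ]

end Moments

/-! ### Reduction of coverage to a studentized inequality. -/

section Coverage

variable {θ : LocParam}

lemma stdSum_eq (n : ℕ) (θ : LocParam) (ξ : Fin n → ℝ) :
    stdSum n θ ξ = (√(n : ℝ))⁻¹ * ∑ i, stdObs θ (ξ i) := by
  simp only [stdSum, stdObs, ← Finset.sum_div]
  field_simp

/-- The empirical variance is location invariant and scales quadratically, so it can be computed on
standardized data as second moment minus squared mean. -/
lemma sampleSd_sq_div_obsSd_sq (hθ : θ ∈ paramSpace) {n : ℕ} (hn : 1 ≤ n) (ξ : Fin n → ℝ) :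
    (sampleSd ξ / obsSd θ) ^ 2 =
      (∑ i, stdObs θ (ξ i) ^ 2) / n - ((∑ i, stdObs θ (ξ i)) / n) ^ 2 := by
  have hn0 : (n : ℝ) ≠ 0 := by positivity
  have hs := (obsSd_pos hθ).ne'
  have h1 (i : Fin n) : ξ i - sampleMean ξ =
      obsSd θ * (stdObs θ (ξ i) - (∑ j, stdObs θ (ξ j)) / n) := by
    simp only [stdObs, ← Finset.sum_div, Finset.sum_sub_distrib, sampleMean, Finset.sum_const,
      Finset.card_univ, Fintype.card_fin, nsmul_eq_mul]
    field_simp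
    ring
  rw [sampleSd, div_pow, Real.sq_sqrt (by positivity)]
  simp_rw [h1, mul_pow, ← Finset.mul_sum, sub_sq, Finset.sum_add_distrib, Finset.sum_sub_distrib,
    ← Finset.sum_mul, ← Finset.mul_sum]
  simp only [Finset.sum_const, Finset.card_univ, Fintype.card_fin, nsmul_eq_mul]
  field_simp
  ring

lemma coverage_ciSigmaHat {α K : ℝ} {δ a : ℕ → ℝ} (hθ : θ ∈ paramSpace) {n : ℕ} (hn : 1 ≤ n)
    (h : quantileOrder α K δ a n < stdNormalCDF (√((n : ℝ) / a n))) :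
    coverage (ciSigmaHat α K δ a) n θ = (sampleLaw n θ).real {ξ | |stdSum n θ ξ| ≤
      sampleSd ξ / obsSd θ *
        (enlargement α K δ a n * stdNormalQuantile (quantileOrder α K δ a n))} := by
  have hn0 : (0 : ℝ) < √(n : ℝ) := by positivity
  have hs := obsSd_pos hθ
  rw [coverage]
  congr 1
  ext ξ
  set t := enlargement α K δ a n * stdNormalQuantile (quantileOrder α K δ a n)
  have h1 : stdSum n θ ξ = (sampleMean ξ - θ.1) * (√(n : ℝ) / obsSd θ) := by
    simp only [stdSum, sampleMean, obsMean_eq hθ, Finset.sum_sub_distrib, Finset.sum_const,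
      Finset.card_univ, Fintype.card_fin, nsmul_eq_mul]
    have : (n : ℝ) = √(n : ℝ) ^ 2 := (Real.sq_sqrt n.cast_nonneg).symm
    rw [div_eq_iff (by positivity)]
    field_simp
    rw [← this]
    ring
  have h2 : sampleSd ξ / obsSd θ * t = (sampleSd ξ / √(n : ℝ) * t) * (√(n : ℝ) / obsSd θ) := by
    field_simp
  simp only [ciSigmaHat, if_pos h, Set.mem_ofPred_eq, Set.mem_Icc]
  rw [h1, h2, abs_mul, abs_of_pos (div_pos hn0 hs), mul_le_mul_iff_left₀ (div_pos hn0 hs), abs_le,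
    mul_assoc]
  constructor <;> rintro ⟨h3, h4⟩ <;> constructor <;> linarith

/-- Closeness of `σ̂ / σ` to `1` follows from closeness of the first two empirical moments. -/
lemma measureReal_sampleSd_div_sub_one_le (hθ : θ ∈ paramSpace) {n : ℕ} (hn : 1 ≤ n) {η : ℝ}
    (hη : 0 < η) :
    (sampleLaw n θ).real {ξ | η ≤ |sampleSd ξ / obsSd θ - 1|} ≤
      (sampleLaw n θ).real {ξ | η / 2 ≤ |(∑ i, stdObs θ (ξ i) ^ 2) / n - 1|} +
        1 / (n * √(η / 2) ^ 2) := by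
  -- The budget `η` is split evenly; the empirical mean enters squared, hence its threshold `√(η /
  -- 2)`.
  have hsub : {ξ : Fin n → ℝ | η ≤ |sampleSd ξ / obsSd θ - 1|} ⊆
      {ξ | η / 2 ≤ |(∑ i, stdObs θ (ξ i) ^ 2) / n - 1|} ∪
        {ξ | √(η / 2) ≤ |(∑ i, stdObs θ (ξ i)) / n - ∫ y, stdObs θ y ∂(obsLaw θ)|} := by
    intro ξ hξ
    by_contra! hcon
    simp only [Set.mem_union, Set.mem_ofPred_eq, not_or, not_le, integral_stdObs hθ,
      sub_zero] at hcon hξ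
    obtain ⟨h1, h2⟩ := hcon
    have h3 := sampleSd_sq_div_obsSd_sq hθ hn ξ
    have hr : 0 ≤ sampleSd ξ / obsSd θ := div_nonneg (Real.sqrt_nonneg _) (obsSd_pos hθ).le
    have h4 : ((∑ i, stdObs θ (ξ i)) / n) ^ 2 < η / 2 := by
      rw [← sq_abs, ← Real.lt_sqrt (abs_nonneg _)]
      exact h2
    set r := sampleSd ξ / obsSd θ
    -- Since `r ≥ 0`, the factor `r + 1` is at least `1`, so no square root needs expanding.
    have h5 : |r - 1| ≤ |r ^ 2 - 1| := by
      rw [show r ^ 2 - 1 = (r - 1) * (r + 1) by ring, abs_mul]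
      exact le_mul_of_one_le_right (abs_nonneg _) (by rw [abs_of_nonneg] <;> linarith)
    have h6 : |r ^ 2 - 1| < η := by
      have := sq_nonneg ((∑ i, stdObs θ (ξ i)) / n)
      rw [abs_lt] at h1 ⊢
      constructor <;> linarith
    linarith
  refine (measureReal_mono hsub).trans ((measureReal_union_le _ _).trans ?_)
  gcongr
  have := measureReal_pi_average_sub_ge_le (memLp_two_stdObs hθ) hn
    (Real.sqrt_pos.2 (half_pos hη))
  rwa [variance_stdObs hθ] at this

lemma tendsto_measureReal_sampleSd_div_sub_one {θ : ℕ → LocParam} (hθ : ∀ n, θ n ∈ paramSpace)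
    (h : ∀ η : ℝ, 0 < η → Tendsto (fun n => (sampleLaw n (θ n)).real
      {ξ | η ≤ |(∑ i, stdObs (θ n) (ξ i) ^ 2) / n - 1|}) atTop (𝓝 0)) {η : ℝ} (hη : 0 < η) :
    Tendsto (fun n => (sampleLaw n (θ n)).real {ξ | η ≤ |sampleSd ξ / obsSd (θ n) - 1|})
      atTop (𝓝 0) := by
  have h1 : Tendsto (fun n : ℕ => 1 / ((n : ℝ) * √(η / 2) ^ 2)) atTop (𝓝 0) := by
    have h2 : 0 < √(η / 2) ^ 2 := by positivity
    simp only [one_div]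
    exact (tendsto_natCast_atTop_atTop.atTop_mul_const h2).inv_tendsto_atTop
  have h3 := (h _ (half_pos hη)).add h1
  rw [add_zero] at h3
  refine squeeze_zero' (Eventually.of_forall fun n => measureReal_nonneg) ?_ h3
  filter_upwards [eventually_ge_atTop 1] with n hn
  exact measureReal_sampleSd_div_sub_one_le (hθ n) hn hη

/-- Coverage along a sequence of parameters for which the standardized sums are asymptotically
normal and the empirical second moments are consistent. -/
lemma tendsto_coverage_ciSigmaHat {α K : ℝ} {δ a : ℕ → ℝ} (hα0 : 0 < α) (hα1 : α < 1)
    (hK : 0 < K) (hδ0 : Tendsto δ atTop (𝓝 0)) (ha : Tendsto a atTop (𝓝 1))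
    (han : Tendsto (fun n : ℕ => (a n - 1) * √(n : ℝ)) atTop atTop)
    {θ : ℕ → LocParam} (hθ : ∀ n, θ n ∈ paramSpace)
    (hS : ∀ x, Tendsto (fun n => (sampleLaw n (θ n)).real {ξ | stdSum n (θ n) ξ ≤ x}) atTop
      (𝓝 (stdNormalCDF x)))
    (hV : ∀ η : ℝ, 0 < η → Tendsto (fun n => (sampleLaw n (θ n)).real
      {ξ | η ≤ |(∑ i, stdObs (θ n) (ξ i) ^ 2) / n - 1|}) atTop (𝓝 0)) :
    Tendsto (fun n => coverage (ciSigmaHat α K δ a) n (θ n)) atTop (𝓝 (1 - α)) := by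
  obtain ⟨z, hz⟩ := exists_stdNormalCDF_eq (τ := 1 - α / 2) (by linarith) (by linarith)
  have hτ := tendsto_quantileOrder (α := α) hδ0 hK ha han
  -- Symmetry gives `Φ(0) = 1/2`, which is below `1 - α/2` because `α < 1`.
  have hz0 : 0 < z := by
    refine strictMono_stdNormalCDF.lt_iff_lt.1 ?_
    have := stdNormalCDF_neg 0
    rw [neg_zero] at this
    linarith
  have key := tendsto_measureReal_abs_le_mul (fun n => measurable_stdSum n (θ n)) hS
    (fun η hη => tendsto_measureReal_sampleSd_div_sub_one hθ hV hη) hz0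
    (tendsto_enlargement_mul_quantile ha (hz.symm ▸ hτ))
  rw [hz, show 2 * (1 - α / 2) - 1 = 1 - α by ring] at key
  refine key.congr' ?_
  filter_upwards [eventually_ge_atTop 1, eventually_quantileOrder_lt hα0 ha hτ] with n hn hn'
  exact (coverage_ciSigmaHat (hθ n) hn hn').symm

end Coverage

/-- Fourth moments may be infinite here, so consistency of the second moment rests on the weak law
for integrable variables rather than on Chebyshev. -/
lemma tendsto_coverage_ciSigmaHat_const {α K : ℝ} {δ a : ℕ → ℝ} (hα0 : 0 < α) (hα1 : α < 1)
    (hK : 0 < K) (hδ0 : Tendsto δ atTop (𝓝 0)) (ha : Tendsto a atTop (𝓝 1))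
    (han : Tendsto (fun n : ℕ => (a n - 1) * √(n : ℝ)) atTop atTop)
    {θ : LocParam} (hθ : θ ∈ paramSpace) :
    Tendsto (fun n => coverage (ciSigmaHat α K δ a) n θ) atTop (𝓝 (1 - α)) := by
  refine tendsto_coverage_ciSigmaHat hα0 hα1 hK hδ0 ha han (fun _ => hθ) (fun x => ?_)
    (fun η hη => ?_)
  · simp only [stdSum_eq]
    exact tendsto_measureReal_pi_sum_le (measurable_stdObs θ) (integral_stdObs hθ)
      (integral_stdObs_sq hθ) x
  · have := tendsto_measureReal_pi_average_sub_ge ((measurable_stdObs θ).pow_const 2)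
      (memLp_two_stdObs hθ).integrable_sq hη
    rwa [integral_stdObs_sq hθ] at this

/-! ### Uniform control over the bounded-kurtosis class. -/

section Uniform

variable {K : ℝ} {θ : LocParam}

lemma abs_edgeworthTerm_le (hK : 0 < K) (hθ : θ ∈ paramSpaceEE K) (n : ℕ) (x : ℝ) :
    |obsSkewness θ / (6 * √(n : ℝ)) * (1 - x ^ 2) * stdNormalPDF x| ≤
      (1 + K) / 2 / (6 * √(n : ℝ)) * 2 := by
  rw [mul_assoc, abs_mul, abs_div, abs_of_nonneg (by positivity : 0 ≤ 6 * √(n : ℝ))]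
  gcongr
  · exact abs_obsSkewness_le hK hθ
  · exact abs_one_sub_sq_mul_stdNormalPDF_le x

/-- Both distances control the Kolmogorov distance to the normal distribution, up to the size of
the Edgeworth term. -/
lemma abs_stdSum_cdf_sub_le (hK : 0 < K) (hθ : θ ∈ paramSpaceEE K) (n : ℕ) (x : ℝ) :
    |(sampleLaw n θ).real {ξ | stdSum n θ ξ ≤ x} - stdNormalCDF x| ≤
      min (deltaE n θ) (deltaB n θ) + (1 + K) / 2 / (6 * √(n : ℝ)) * 2 := by
  have hdiff (y : ℝ) :
      |(sampleLaw n θ).real {ξ | stdSum n θ ξ ≤ y} - stdNormalCDF y| ≤ 1 := by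
    have h1 := stdNormalCDF_mem_Icc y
    have h2 : (sampleLaw n θ).real {ξ | stdSum n θ ξ ≤ y} ∈ Set.Icc (0 : ℝ) 1 :=
      ⟨measureReal_nonneg, measureReal_le_one⟩
    rw [abs_le]
    constructor <;> linarith [h1.1, h1.2, h2.1, h2.2]
  have hedge := abs_edgeworthTerm_le hK hθ n
  have hc : 0 ≤ (1 + K) / 2 / (6 * √(n : ℝ)) * 2 := by positivity
  rcases min_choice (deltaE n θ) (deltaB n θ) with h | h <;> rw [h]
  · have hE : |(sampleLaw n θ).real {ξ | stdSum n θ ξ ≤ x} - stdNormalCDF x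
        - obsSkewness θ / (6 * √(n : ℝ)) * (1 - x ^ 2) * stdNormalPDF x| ≤ deltaE n θ := by
      refine le_ciSup (f := fun y => |(sampleLaw n θ).real {ξ | stdSum n θ ξ ≤ y} - stdNormalCDF y
        - obsSkewness θ / (6 * √(n : ℝ)) * (1 - y ^ 2) * stdNormalPDF y|) ?_ x
      -- The family must be shown bounded: a real supremum of an unbounded family is `0` and would
      -- control nothing.
      refine ⟨1 + (1 + K) / 2 / (6 * √(n : ℝ)) * 2, ?_⟩
      rintro _ ⟨y, rfl⟩
      exact (abs_sub _ _).trans (add_le_add (hdiff y) (hedge y))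
    have := abs_add_le ((sampleLaw n θ).real {ξ | stdSum n θ ξ ≤ x} - stdNormalCDF x
        - obsSkewness θ / (6 * √(n : ℝ)) * (1 - x ^ 2) * stdNormalPDF x)
      (obsSkewness θ / (6 * √(n : ℝ)) * (1 - x ^ 2) * stdNormalPDF x)
    rw [sub_add_cancel] at this
    linarith [hedge x]
  · have hB : |(sampleLaw n θ).real {ξ | stdSum n θ ξ ≤ x} - stdNormalCDF x| ≤ deltaB n θ := by
      refine le_ciSup (f := fun y =>
        |(sampleLaw n θ).real {ξ | stdSum n θ ξ ≤ y} - stdNormalCDF y|) ⟨1, ?_⟩ x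
      rintro _ ⟨y, rfl⟩
      exact hdiff y
    linarith

/-- Both inputs hold with rates depending on `K`, `δ` and `n` but not on `θ`, so the parameter may
move with `n`. -/
lemma tendsto_coverage_ciSigmaHat_of_mem_paramSpaceEE {α K : ℝ} {δ a : ℕ → ℝ} (hα0 : 0 < α)
    (hα1 : α < 1) (hK : 0 < K)
    (hδ : ∀ n : ℕ, 1 ≤ n → ∀ θ ∈ paramSpaceEE K, min (deltaE n θ) (deltaB n θ) ≤ δ n)
    (hδ0 : Tendsto δ atTop (𝓝 0)) (ha : Tendsto a atTop (𝓝 1))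
    (han : Tendsto (fun n : ℕ => (a n - 1) * √(n : ℝ)) atTop atTop)
    {θ : ℕ → LocParam} (hθ : ∀ n, θ n ∈ paramSpaceEE K) :
    Tendsto (fun n => coverage (ciSigmaHat α K δ a) n (θ n)) atTop (𝓝 (1 - α)) := by
  refine tendsto_coverage_ciSigmaHat hα0 hα1 hK hδ0 ha han (fun n => (hθ n).1) (fun x => ?_)
    (fun η hη => ?_)
  · have h1 : Tendsto (fun n : ℕ => (1 + K) / 2 / (6 * √(n : ℝ)) * 2) atTop (𝓝 0) := by
      have h2 : Tendsto (fun n : ℕ => 6 * √(n : ℝ)) atTop atTop :=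
        (Real.tendsto_sqrt_atTop.comp tendsto_natCast_atTop_atTop).const_mul_atTop (by norm_num)
      simpa using (h2.const_div_atTop ((1 + K) / 2)).mul_const 2
    have h2 := hδ0.add h1
    rw [add_zero] at h2
    rw [tendsto_iff_norm_sub_tendsto_zero]
    refine squeeze_zero' (Eventually.of_forall fun n => norm_nonneg _) ?_ h2
    filter_upwards [eventually_ge_atTop 1] with n hn
    have := abs_stdSum_cdf_sub_le hK (hθ n) n x
    rw [Real.norm_eq_abs]
    linarith [hδ n hn _ (hθ n)]
  · have h1 : Tendsto (fun n : ℕ => K / ((n : ℝ) * η ^ 2)) atTop (𝓝 0) :=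
      (tendsto_natCast_atTop_atTop.atTop_mul_const (by positivity)).const_div_atTop K
    refine squeeze_zero' (Eventually.of_forall fun n => measureReal_nonneg) ?_ h1
    filter_upwards [eventually_ge_atTop 1] with n hn
    have h2 := measureReal_pi_average_sub_ge_le (memLp_two_stdObs_sq (hθ n)) hn hη
    rw [integral_stdObs_sq (hθ n).1] at h2
    refine h2.trans ?_
    gcongr
    exact variance_stdObs_sq_le hK (hθ n)

end Uniform

/-- Uniform asymptotic exactness follows from exactness along all sequences of parameters. -/
lemma asympExactUniform_of_forall_seq {CS : (n : ℕ) → (Fin n → ℝ) → Set ℝ} {S : Set LocParam}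
    {α : ℝ} (h : ∀ θ : ℕ → LocParam, (∀ n, θ n ∈ S) →
      Tendsto (fun n => coverage CS n (θ n)) atTop (𝓝 (1 - α))) :
    AsympExactUniform CS S α := by
  rcases isEmpty_or_nonempty S with hS | hS
  · simp [AsympExactUniform, Real.iSup_of_isEmpty]
  -- Near-maximizers, within `1/(n + 1)` of the supremum, form the sequence to test; the shift keeps
  -- the slack positive at `n = 0`.
  · have hex (n : ℕ) : ∃ θ : S, (⨆ θ : S, |coverage CS n (θ : LocParam) - (1 - α)|)
        - 1 / ((n : ℝ) + 1) < |coverage CS n (θ : LocParam) - (1 - α)| :=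
      exists_lt_of_lt_ciSup (sub_lt_self _ (by positivity))
    choose θ hθ using hex
    have h1 := (tendsto_iff_norm_sub_tendsto_zero.1 (h (fun n => θ n) fun n => (θ n).2)).add
      tendsto_one_div_add_atTop_nhds_zero_nat
    rw [add_zero] at h1
    refine squeeze_zero (fun n => Real.iSup_nonneg fun _ => abs_nonneg _) (fun n => ?_) h1
    rw [Real.norm_eq_abs]
    linarith [hθ n]

theorem mainTheorem7 (α K : ℝ) (hα0 : 0 < α) (hα1 : α < 1) (hK : 0 < K) (δ a b : ℕ → ℝ)
    (hδ : ∀ n : ℕ, 1 ≤ n → ∀ θ ∈ paramSpaceEE K, min (deltaE n θ) (deltaB n θ) ≤ δ n)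
    (hδ0 : Tendsto δ atTop (𝓝 0))
    (hb : ∀ n : ℕ, b n = a n - 1)
    (hb0 : Tendsto b atTop (𝓝 0))
    (hbn : Tendsto (fun n : ℕ => b n * √(n : ℝ)) atTop atTop) :
    AsympExactPointwise (ciSigmaHat α K δ a) paramSpace α ∧
      AsympExactUniform (ciSigmaHat α K δ a) (paramSpaceEE K) α := by
  have ha : Tendsto a atTop (𝓝 1) := by
    simpa [hb] using hb0.add_const 1
  simp only [hb] at hbn
  exact ⟨fun θ hθ => tendsto_coverage_ciSigmaHat_const hα0 hα1 hK hδ0 ha hbn hθ,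
    asympExactUniform_of_forall_seq fun θ hθ =>
      tendsto_coverage_ciSigmaHat_of_mem_paramSpaceEE hα0 hα1 hK hδ hδ0 ha hbn hθ⟩
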